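/- Definitions. Let $\{\pm1\}^d$ be the hypercube with its coordinatewise product, and let $\mathbb E$ denote the average over it. A connection with expectation $p$ is a function $\sigma:\{\pm1\}^d\to[0,1]$ with $\mathbb E[\sigma]=p$; it is symmetric if its value is unchanged by permuting the coordinates, and it is $L$-Lipschitz if changing any single coordinate of the argument changes the value by at most $L$. The random algebraic graph $\mathsf{RAG}(n,\{\pm1\}^d,p,\sigma)$ is the random graph on $[n]$ obtained by drawing $\mathbf x_1,\dots,\mathbf x_n$ independently and uniformly from $\{\pm1\}^d$ and then joining each pair $i<j$ independently with probability $\sigma(\mathbf x_i^{-1}\mathbf x_j)$. $\mathsf G(n,p)$ is the Erdős–Rényi graph and $\mathsf{KL}$ is the Kullback–Leibler divergence. Corollary 4.4. There is a function $C:[0,1]\to(0,\infty)$, continuous on $(0,1)$, with the following property. For every $n\in\mathbb N$ let $d=d_n\in\mathbb N$, $r=r_n>0$ and $p=p_n\in[0,1]$, and let $\sigma=\sigma_n:\{\pm1\}^{d}\to[0,1]$ be a symmetric $\frac{1}{r\sqrt d}$-Lipschitz connection with expectation $p$ (no monotonicity is assumed). Suppose that, as $n\to\infty$, $d=\omega_p\big(\tfrac{n^3}{r^4}\big)$,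 in the sense that $C(p_n)\,\tfrac{n^3}{r_n^4}=o(d_n)$, and that $d=\Omega(n\log n)$, that is, $d_n\ge c\,n\log n$ for some constant $c>0$ and all sufficiently large $n$. Then $$\mathsf{KL}\big(\mathsf{RAG}(n,\{\pm1\}^{d},p,\sigma)\,\big\|\,\mathsf G(n,p)\big)\to 0\qquad(n\to\infty).$$ -/

import Mathlib

open Filter Asymptotics Topology MeasureTheory
open scoped BigOperators

noncomputable section

/-- The Boolean hypercube `{±1}^d`, with its coordinatewise group structure. -/
abbrev Cube (d : ℕ) : Type := Fin d → ℤˣ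

/-- The probability of the graph `G` on `[n]` when each pair `i < j` is joined independently with
probability `w i j`. -/
def edgeProduct {n : ℕ} (w : Fin n → Fin n → ℝ) (G : SimpleGraph (Fin n)) : ℝ :=
  open Classical in
  ∏ i : Fin n, ∏ j ∈ Finset.Ioi i, if G.Adj i j then w i j else 1 - w i j

/-- The probability of the graph `G` in the probabilistic latent space graph model on `n` vertices
over the finite latent space `Ω` with the uniform distribution and connection `ζ`: the average of
`edgeProduct` over `n` independent uniform latent vectors `x 0, …, x (n - 1)`. -/
def plsgProb (n : ℕ) {Ω : Type*} [Fintype Ω] (ζ : Ω → Ω → ℝ) (G : SimpleGraph (Fin n)) : ℝ :=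
  𝔼 x : Fin n → Ω, edgeProduct (fun i j => ζ (x i) (x j)) G

/-- The law of the probabilistic latent space graph, as a measure on graphs with vertex set
`Fin n`. -/
def PLSG (n : ℕ) {Ω : Type*} [Fintype Ω] (ζ : Ω → Ω → ℝ) : Measure (SimpleGraph (Fin n)) :=
  ∑ G : SimpleGraph (Fin n), ENNReal.ofReal (plsgProb n ζ G) • Measure.dirac G

/-- The law of the random algebraic graph over a finite group `Γ` (with its uniform distribution):
vertices `i`, `j` are joined with probability `σ ((x i)⁻¹ * x j)`. -/
def RAG (n : ℕ) (Γ : Type*) [Group Γ] [Fintype Γ] (σ : Γ → ℝ) : Measure (SimpleGraph (Fin n)) :=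
  PLSG n (fun x y : Γ => σ (x⁻¹ * y))

/-- `σ` is a connection on the hypercube with expectation `p`. -/
def IsConnection {d : ℕ} (p : ℝ) (σ : Cube d → ℝ) : Prop :=
  (∀ x, σ x ∈ Set.Icc (0 : ℝ) 1) ∧ 𝔼 x, σ x = p

/-- `σ` is symmetric: invariant under permutations of the coordinates. -/
def IsSymmetricConnection {d : ℕ} (σ : Cube d → ℝ) : Prop :=
  ∀ (τ : Equiv.Perm (Fin d)) (x : Cube d), σ (x ∘ τ) = σ x

/-- `f` is `L`-Lipschitz for the Hamming distance: changing one coordinate from `1` to `-1` changes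
the value by at most `L`. -/
def HammingLipschitz {d : ℕ} (L : ℝ) (f : Cube d → ℝ) : Prop :=
  ∀ (i : Fin d) (x : Cube d), |f (Function.update x i 1) - f (Function.update x i (-1))| ≤ L

end

/-! Expose the vertices one at a time. By the chain rule, adding a vertex to `k` others costs at
most the log of the second moment of the likelihood ratio of its neighbourhood, with the old latent
vectors treated as known (`sum_mul_log_expect_mul_le`). Two independent copies of the new latent
vector turn that moment into `𝔼 g, (1 + γ g / (p (1 - p))) ^ k`, where `γ` is the autocorrelation of
`σ - p` (`expect_sum_rowProb_sq_div`).

The gain comes from `γ` being smoother than `σ`: it has mean zero and is `L ^ 2 / 2`-Lipschitz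
(`hammingLipschitz_autocorrelation`). Bounded differences then give `exp (k ^ 2 * d * L ^ 4 / (p (1
- p)) ^ 2)`. Summing exponents over `k < n` bounds the divergence by `n ^ 3 * d * L ^ 4 / (p (1 -
p)) ^ 2`, and `d * L ^ 4 = 1 / (r ^ 4 * d)`. -/

/-! ### Bounded differences on the hypercube -/

/-- Averaging over `n + 1` coordinates is averaging over the first one and over the others. -/
lemma expect_fin_cons {Ω : Type*} [Fintype Ω] (n : ℕ) (f : (Fin (n + 1) → Ω) → ℝ) :
    𝔼 x, f x = 𝔼 y : Ω, 𝔼 x : Fin n → Ω, f (Fin.cons y x) := by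
  rw [← Finset.expect_product' (s := Finset.univ) (t := Finset.univ)
    (f := fun (y : Ω) (x : Fin n → Ω) => f (Fin.cons y x))]
  rw [Finset.univ_product_univ]
  exact (Fintype.expect_equiv (Fin.consEquiv fun _ => Ω) _ _ fun _ => rfl).symm

lemma expect_intUnits (f : ℤˣ → ℝ) : 𝔼 y, f y = (f 1 + f (-1)) / 2 := by
  rw [Fintype.expect_eq_sum_div_card]
  have h : (Finset.univ : Finset ℤˣ) = {1, -1} := by decide
  have h1 : (1 : ℤˣ) ≠ -1 := by decide
  rw [h, Finset.sum_pair h1]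
  simp

/-- Hoeffding's lemma for a two-point variable, from `cosh t ≤ exp (t ^ 2 / 2)` at `t = (a - b) /
2`. -/
lemma add_exp_div_two_le (a b c : ℝ) (h : |a - b| ≤ c) :
    (Real.exp a + Real.exp b) / 2 ≤ Real.exp ((a + b) / 2 + c ^ 2 / 8) := by
  have e1 : (Real.exp a + Real.exp b) / 2 = Real.exp ((a + b) / 2) * Real.cosh ((a - b) / 2) := by
    rw [Real.cosh_eq, mul_div_assoc', mul_add, ← Real.exp_add, ← Real.exp_add]
    ring_nf
  rw [e1, Real.exp_add]
  refine mul_le_mul_of_nonneg_left ?_ (Real.exp_pos _).le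
  refine (Real.cosh_le_exp_half_sq _).trans (Real.exp_le_exp.2 ?_)
  have := sq_le_sq' (abs_le.1 h).1 (abs_le.1 h).2
  nlinarith

/-- The bounded differences inequality on the hypercube. -/
lemma expect_exp_le_of_hammingLipschitz {d : ℕ} {c : ℝ} {F : Cube d → ℝ}
    (hF : HammingLipschitz c F) :
    𝔼 x, Real.exp (F x) ≤ Real.exp (𝔼 x, F x + d * c ^ 2 / 8) := by
  induction d with
  | zero => simp
  | succ d ih =>
    -- Averaging out the first coordinate keeps the mean and the Lipschitz constant and costs a
    -- factor `exp (c ^ 2 / 8)`.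
    let A : Cube d → ℝ := fun x => (F (Fin.cons 1 x) + F (Fin.cons (-1) x)) / 2
    have hA : HammingLipschitz c A := by
      intro i x
      have h1 := hF i.succ (Fin.cons 1 x)
      have h2 := hF i.succ (Fin.cons (-1) x)
      simp only [← Fin.cons_update] at h1 h2
      simp only [A]
      rw [abs_le] at *
      constructor <;> linarith
    have hFA : 𝔼 x, F x = 𝔼 x, A x := by
      rw [expect_fin_cons, Finset.expect_comm]
      exact Finset.expect_congr rfl fun x _ => expect_intUnits _
    calc 𝔼 x, Real.exp (F x)
        = 𝔼 x : Cube d, (Real.exp (F (Fin.cons 1 x)) + Real.exp (F (Fin.cons (-1) x))) / 2 := by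
          rw [expect_fin_cons, Finset.expect_comm]
          exact Finset.expect_congr rfl fun x _ => expect_intUnits _
      _ ≤ 𝔼 x : Cube d, Real.exp (A x) * Real.exp (c ^ 2 / 8) := by
          refine Finset.expect_le_expect fun x _ => ?_
          rw [← Real.exp_add]
          refine add_exp_div_two_le _ _ _ ?_
          simpa using hF 0 (Fin.cons 1 x)
      _ ≤ Real.exp (𝔼 x, A x + d * c ^ 2 / 8) * Real.exp (c ^ 2 / 8) := by
          rw [← Finset.expect_mul]
          exact mul_le_mul_of_nonneg_right (ih hA) (Real.exp_pos _).le
      _ = Real.exp (𝔼 x, F x + (d + 1 : ℕ) * c ^ 2 / 8) := by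
          rw [← Real.exp_add, hFA]
          push_cast
          ring_nf

/-! ### Autocorrelation of a connection -/

/-- The autocorrelation at `g` of the deviation of `σ` from `p`. -/
noncomputable def autocorrelation {Γ : Type*} [Group Γ] [Fintype Γ] (p : ℝ) (σ : Γ → ℝ) (g : Γ) :
    ℝ :=
  𝔼 z, (σ z - p) * (σ (g * z) - p)

lemma expect_mul_left {Γ : Type*} [Group Γ] [Fintype Γ] (f : Γ → ℝ) (g : Γ) :
    𝔼 z, f (g * z) = 𝔼 z, f z :=
  Fintype.expect_equiv (Equiv.mulLeft g) _ _ fun _ => rfl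

lemma expect_mul_right {Γ : Type*} [Group Γ] [Fintype Γ] (f : Γ → ℝ) (g : Γ) :
    𝔼 z, f (z * g) = 𝔼 z, f z :=
  Fintype.expect_equiv (Equiv.mulRight g) _ _ fun _ => rfl

lemma expect_inv {Γ : Type*} [Group Γ] [Fintype Γ] (f : Γ → ℝ) :
    𝔼 z, f z⁻¹ = 𝔼 z, f z :=
  Fintype.expect_equiv (Equiv.inv Γ) _ _ fun _ => rfl

lemma expect_autocorrelation {Γ : Type*} [Group Γ] [Fintype Γ] {p : ℝ} {σ : Γ → ℝ}
    (h : 𝔼 x, σ x = p) : 𝔼 g, autocorrelation p σ g = 0 := by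
  simp only [autocorrelation]
  rw [Finset.expect_comm]
  refine Finset.expect_eq_zero fun z _ => ?_
  rw [← Finset.mul_expect, expect_mul_right (fun x => σ x - p) z, Finset.expect_sub_distrib, h]
  simp

lemma HammingLipschitz.abs_flip_sub_le {d : ℕ} {L : ℝ} {f : Cube d → ℝ} (hf : HammingLipschitz L f)
    (i : Fin d) (x : Cube d) : |f (Pi.mulSingle i (-1) * x) - f x| ≤ L := by
  have key : ∀ u : ℤˣ, x i = u → Pi.mulSingle i (-1) * x = Function.update x i (-u) := by
    rintro u rfl
    ext j
    by_cases h : j = i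
    · subst h; simp
    · simp [h]
  rcases Int.units_eq_one_or (x i) with h | h
  · rw [key 1 h, abs_sub_comm]
    have := hf i x
    rwa [← h, Function.update_eq_self, h] at this
  · rw [key (-1) h, neg_neg]
    have := hf i x
    rw [← h, Function.update_eq_self] at this
    exact this

/-- Flipping a coordinate of the argument can be moved onto either factor of the correlation.
Averaging the two forms leaves a product of two discrete derivatives of `σ`, hence `L ^ 2` instead
of `L`. -/
lemma hammingLipschitz_autocorrelation {d : ℕ} {L p : ℝ} {σ : Cube d → ℝ}
    (hσ : HammingLipschitz L σ) : HammingLipschitz (L ^ 2 / 2) (autocorrelation p σ) := by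
  intro i x
  set h := Function.update x i 1 with hh
  let e : Cube d := Pi.mulSingle i (-1)
  have he : Function.update x i (-1) = e * h := by
    ext j
    by_cases hj : j = i
    · subst hj; simp [e, h]
    · simp [hj, e, h]
  have hee : e * e = 1 := by
    simp [e, ← Pi.mulSingle_mul]
  let f : Cube d → ℝ := fun z => σ z - p
  have hdiff : autocorrelation p σ h - autocorrelation p σ (e * h)
      = 𝔼 z, f z * (f (h * z) - f (e * (h * z))) := by
    simp only [autocorrelation, f]
    rw [← Finset.expect_sub_distrib]
    refine Finset.expect_congr rfl fun z _ => ?_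
    rw [mul_assoc]; ring
  -- Substituting `e * z` for `z` swaps the two shifted values, since `e` is an involution.
  have hshift : autocorrelation p σ h - autocorrelation p σ (e * h)
      = 𝔼 z, f (e * z) * (f (e * (h * z)) - f (h * z)) := by
    rw [hdiff, ← expect_mul_left _ e]
    refine Finset.expect_congr rfl fun z _ => ?_
    have h1 : h * (e * z) = e * (h * z) := by rw [mul_left_comm]
    have h2 : e * (e * (h * z)) = h * z := by rw [← mul_assoc, hee, one_mul]
    rw [h1, h2]
  have hsum : autocorrelation p σ h - autocorrelation p σ (e * h)
      = 𝔼 z, (f (e * z) - f z) * (f (e * (h * z)) - f (h * z)) / 2 := by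
    have : autocorrelation p σ h - autocorrelation p σ (e * h)
      = (𝔼 z, f z * (f (h * z) - f (e * (h * z)))
        + 𝔼 z, f (e * z) * (f (e * (h * z)) - f (h * z))) / 2 := by
      rw [← hdiff, ← hshift]; ring
    rw [this, ← Finset.expect_add_distrib, Finset.expect_div]
    refine Finset.expect_congr rfl fun z _ => ?_
    ring
  rw [he, hsum]
  refine (Finset.abs_expect_le _ _).trans ?_
  refine Finset.expect_le Finset.univ_nonempty fun z _ => ?_
  rw [abs_div, abs_mul, abs_two, sq]
  have h1 := hσ.abs_flip_sub_le i z
  have h2 := hσ.abs_flip_sub_le i (h * z)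
  simp only [f, sub_sub_sub_cancel_right]
  gcongr
  exact (abs_nonneg _).trans h1

/-- The moment of `1 + γ / s` is bounded for a Lipschitz connection with autocorrelation `γ`. -/
lemma expect_one_add_autocorrelation_pow_le {d : ℕ} {L p s : ℝ} {σ : Cube d → ℝ} (hs : 0 < s)
    (hσ : HammingLipschitz L σ) (hp : 𝔼 x, σ x = p)
    (hnn : ∀ g, 0 ≤ 1 + autocorrelation p σ g / s) (k : ℕ) :
    𝔼 g, (1 + autocorrelation p σ g / s) ^ k ≤ Real.exp ((k : ℝ) ^ 2 * (d * L ^ 4 / s ^ 2)) := by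
  have hlip : HammingLipschitz (k * (L ^ 2 / 2) / s)
      (fun g => k * (autocorrelation p σ g / s)) := by
    intro i x
    have := hammingLipschitz_autocorrelation (p := p) hσ i x
    rw [← mul_sub, ← sub_div, mul_div_assoc', abs_div, abs_mul, abs_of_pos hs, Nat.abs_cast]
    gcongr
  calc 𝔼 g, (1 + autocorrelation p σ g / s) ^ k
      ≤ 𝔼 g, Real.exp (k * (autocorrelation p σ g / s)) := by
        refine Finset.expect_le_expect fun g _ => ?_
        rw [Real.exp_nat_mul]
        refine pow_le_pow_left₀ (hnn g) ?_ k
        rw [add_comm]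
        exact Real.add_one_le_exp _
    _ ≤ Real.exp (𝔼 g, k * (autocorrelation p σ g / s) + d * (k * (L ^ 2 / 2) / s) ^ 2 / 8) :=
        expect_exp_le_of_hammingLipschitz hlip
    _ ≤ Real.exp ((k : ℝ) ^ 2 * (d * L ^ 4 / s ^ 2)) := by
        rw [← Finset.mul_expect, ← Finset.expect_div, expect_autocorrelation hp]
        refine Real.exp_le_exp.2 ?_
        -- The true exponent carries a factor `1 / 32`, which is discarded.
        have h0 : 0 ≤ (k : ℝ) ^ 2 * (d * L ^ 4 / s ^ 2) := by positivity
        have : (k : ℝ) * (0 / s) + d * (k * (L ^ 2 / 2) / s) ^ 2 / 8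
            = (k : ℝ) ^ 2 * (d * L ^ 4 / s ^ 2) / 32 := by
          field_simp
          ring
        rw [this]
        linarith

/-! ### Chain rule for the divergence -/

/-- One step of the chain rule for the Kullback-Leibler divergence of mixtures of products. -/
lemma sum_mul_log_expect_mul_le {X A B : Type*} [Fintype X] [Nonempty X] [Fintype A] [Fintype B]
    {e : X → A → ℝ} {W : X → B → ℝ} {Q : A → ℝ} {q : B → ℝ} {c : ℝ}
    (he : ∀ x a, 0 ≤ e x a) (hW : ∀ x b, 0 ≤ W x b) (hQ : ∀ a, 0 < Q a) (hq : ∀ b, 0 < q b)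
    (he1 : ∀ x, ∑ a, e x a = 1) (hW1 : ∀ x, ∑ b, W x b = 1)
    (hc : 𝔼 x, ∑ b, W x b ^ 2 / q b ≤ Real.exp c) :
    ∑ a, ∑ b, (𝔼 x, e x a * W x b) * Real.log ((𝔼 x, e x a * W x b) / (Q a * q b))
      ≤ ∑ a, (𝔼 x, e x a) * Real.log ((𝔼 x, e x a) / Q a) + c := by
  have hPP : ∀ a b, 0 ≤ 𝔼 x, e x a * W x b := fun a b =>
    Finset.expect_nonneg fun x _ => mul_nonneg (he x a) (hW x b)
  have hP : ∀ a, 0 ≤ 𝔼 x, e x a := fun a => Finset.expect_nonneg fun x _ => he x a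
  have hE : ∀ a b, 0 ≤ 𝔼 x, e x a * W x b ^ 2 := fun a b =>
    Finset.expect_nonneg fun x _ => mul_nonneg (he x a) (sq_nonneg _)
  have hmarg : ∀ a, ∑ b, 𝔼 x, e x a * W x b = 𝔼 x, e x a := by
    intro a
    rw [← Finset.expect_sum_comm]
    refine Finset.expect_congr rfl fun x _ => ?_
    rw [← Finset.mul_sum, hW1, mul_one]
  -- Given `a`, the law of `b` is a posterior average of the `W x`; Cauchy–Schwarz bounds the square
  -- of this average by the average of the squares.
  have hcs : ∀ a b, (𝔼 x, e x a * W x b) ^ 2 ≤ (𝔼 x, e x a) * 𝔼 x, e x a * W x b ^ 2 := by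
    intro a b
    simp only [Fintype.expect_eq_sum_div_card]
    rw [div_pow, div_mul_div_comm, ← sq]
    refine div_le_div_of_nonneg_right ?_ (sq_nonneg _)
    refine Finset.sum_sq_le_sum_mul_sum_of_sq_le_mul _ (fun x _ => he x a)
      (fun x _ => mul_nonneg (he x a) (sq_nonneg _)) fun x _ => ?_
    exact le_of_eq (by ring)
  -- Jensen in pointwise form: `log u ≤ u - 1` for the conditional likelihood ratio tilted by `exp
  -- (-c)`. The tilt makes the summed error at most `1 + (c - 1) = c`.
  have hterm : ∀ a b,
      (𝔼 x, e x a * W x b) * Real.log ((𝔼 x, e x a * W x b) / (Q a * q b))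
      ≤ (𝔼 x, e x a * W x b) * Real.log ((𝔼 x, e x a) / Q a)
        + Real.exp (-c) * ((𝔼 x, e x a * W x b ^ 2) / q b)
        + (c - 1) * 𝔼 x, e x a * W x b := by
    intro a b
    have hcs' := hcs a b
    have hE' := hE a b
    have hQa := hQ a
    have hqb := hq b
    rcases (hPP a b).eq_or_lt with h0 | hpos
    · rw [← h0]
      simp only [zero_mul, mul_zero, zero_add, add_zero]
      exact mul_nonneg (Real.exp_pos _).le (div_nonneg hE' hqb.le)
    · have hPpos : 0 < 𝔼 x, e x a := by
        rcases (hP a).eq_or_lt with h | h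
        · rw [← h, zero_mul] at hcs'
          exact absurd hcs' (not_le.2 (by positivity))
        · exact h
      generalize 𝔼 x, e x a * W x b = R at *
      generalize 𝔼 x, e x a = P at *
      generalize 𝔼 x, e x a * W x b ^ 2 = E at *
      have hlog : Real.log (R / (Q a * q b))
          = Real.log (P / Q a) + (Real.log (R / (P * q b) * Real.exp (-c)) + c) := by
        rw [Real.log_mul (by positivity) (by positivity), Real.log_exp, neg_add_cancel_right,
          ← Real.log_mul (by positivity) (by positivity)]
        congr 1
        field_simp
      have hl := Real.log_le_sub_one_of_pos
        (show 0 < R / (P * q b) * Real.exp (-c) by positivity)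
      have hR : R * (R / (P * q b)) ≤ E / q b := by
        rw [mul_div_assoc', div_le_div_iff₀ (by positivity) hqb]
        nlinarith
      rw [hlog]
      have h1 := mul_le_mul_of_nonneg_left hl hpos.le
      have h2 := mul_le_mul_of_nonneg_left hR (Real.exp_pos (-c)).le
      nlinarith
  have hS : ∑ a, ∑ b, (𝔼 x, e x a * W x b ^ 2) / q b = 𝔼 x, ∑ b, W x b ^ 2 / q b := by
    simp only [Finset.expect_div]
    simp only [← Finset.expect_sum_comm]
    refine Finset.expect_congr rfl fun x _ => ?_
    rw [Finset.sum_comm]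
    refine Finset.sum_congr rfl fun b _ => ?_
    rw [← Finset.sum_div, ← Finset.sum_mul, he1, one_mul]
  have hP1 : ∑ a, 𝔼 x, e x a = 1 := by
    rw [← Finset.expect_sum_comm]
    simp [he1]
  calc _ ≤ ∑ a, ∑ b, ((𝔼 x, e x a * W x b) * Real.log ((𝔼 x, e x a) / Q a)
        + Real.exp (-c) * ((𝔼 x, e x a * W x b ^ 2) / q b)
        + (c - 1) * 𝔼 x, e x a * W x b) :=
        Finset.sum_le_sum fun a _ => Finset.sum_le_sum fun b _ => hterm a b
    _ = ∑ a, (𝔼 x, e x a) * Real.log ((𝔼 x, e x a) / Q a)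
        + Real.exp (-c) * 𝔼 x, ∑ b, W x b ^ 2 / q b + (c - 1) := by
        simp only [Finset.sum_add_distrib, ← Finset.sum_mul, ← Finset.mul_sum, hmarg, hS, hP1,
          mul_one]
    _ ≤ _ := by
        have := mul_le_mul_of_nonneg_left hc (Real.exp_pos (-c)).le
        rw [← Real.exp_add, neg_add_cancel, Real.exp_zero] at this
        linarith

/-! ### Graphs built vertex by vertex -/

/-- A graph on `n + 1` vertices is a graph on the last `n` of them with the set of neighbours
of the first. -/
noncomputable def SimpleGraph.finSuccEquiv (n : ℕ) :
    SimpleGraph (Fin (n + 1)) ≃ SimpleGraph (Fin n) × (Fin n → Bool) where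
  toFun G := open Classical in (G.comap Fin.succ, fun j => decide (G.Adj 0 j.succ))
  invFun H :=
    { Adj := fun i j => Fin.cases (Fin.cases False (fun j => H.2 j = true) j)
        (fun i => Fin.cases (H.2 i = true) (fun j => H.1.Adj i j) j) i
      symm := ⟨fun i j => by
        induction i using Fin.cases <;> induction j using Fin.cases <;>
          simp [H.1.adj_comm]⟩
      loopless := ⟨fun i => by induction i using Fin.cases <;> simp⟩ }
  left_inv G := by
    ext i j
    induction i using Fin.cases <;> induction j using Fin.cases <;> simp [G.adj_comm]
  right_inv H := by
    refine Prod.ext (by ext; simp) (funext fun j => ?_)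
    cases h : H.2 j <;> simp [h]

lemma edgeProduct_succ {n : ℕ} (w : Fin (n + 1) → Fin (n + 1) → ℝ) (G : SimpleGraph (Fin (n + 1))) :
    edgeProduct w G = edgeProduct (fun i j => w i.succ j.succ) (SimpleGraph.finSuccEquiv n G).1 *
      ∏ j, if (SimpleGraph.finSuccEquiv n G).2 j then w 0 j.succ else 1 - w 0 j.succ := by
  simp only [edgeProduct]
  rw [Fin.prod_univ_succ, Fin.prod_Ioi_zero, mul_comm]
  simp only [Fin.prod_Ioi_succ, SimpleGraph.finSuccEquiv, Equiv.coe_fn_mk]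
  congr 1
  refine Finset.prod_congr rfl fun j _ => ?_
  by_cases h : G.Adj 0 j.succ <;> simp [h]

lemma edgeProduct_nonneg {n : ℕ} {w : Fin n → Fin n → ℝ} (hw : ∀ i j, w i j ∈ Set.Icc (0 : ℝ) 1)
    (G : SimpleGraph (Fin n)) : 0 ≤ edgeProduct w G := by
  refine Finset.prod_nonneg fun i _ => Finset.prod_nonneg fun j _ => ?_
  split_ifs
  · exact (hw i j).1
  · exact sub_nonneg.2 (hw i j).2

lemma edgeProduct_pos {n : ℕ} {w : Fin n → Fin n → ℝ} (hw : ∀ i j, w i j ∈ Set.Ioo (0 : ℝ) 1)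
    (G : SimpleGraph (Fin n)) : 0 < edgeProduct w G := by
  refine Finset.prod_pos fun i _ => Finset.prod_pos fun j _ => ?_
  split_ifs
  · exact (hw i j).1
  · exact sub_pos.2 (hw i j).2

lemma sum_prod_ite {n : ℕ} (u v : Fin n → ℝ) :
    ∑ b : Fin n → Bool, ∏ j, (if b j then u j else v j) = ∏ j, (u j + v j) := by
  rw [← Fintype.piFinset_univ,
    ← Finset.prod_univ_sum (fun _ => Finset.univ) (fun j (b : Bool) => if b then u j else v j)]
  simp

lemma sum_edgeProduct {n : ℕ} (w : Fin n → Fin n → ℝ) : ∑ G, edgeProduct w G = 1 := by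
  induction n with
  | zero => simp [edgeProduct]
  | succ n ih =>
    rw [← (SimpleGraph.finSuccEquiv n).symm.sum_comp, Fintype.sum_prod_type]
    simp only [edgeProduct_succ, Equiv.apply_symm_apply, ← Finset.mul_sum, sum_prod_ite, add_sub_cancel]
    simp [ih]

lemma expect_prod_pi {Ω : Type*} [Fintype Ω] (n : ℕ) (h : Ω → ℝ) :
    𝔼 x : Fin n → Ω, ∏ j, h (x j) = (𝔼 z, h z) ^ n := by
  simp only [Fintype.expect_eq_sum_div_card]
  rw [div_pow, Fintype.card_fun, Fintype.card_fin, ← Fintype.piFinset_univ,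
    Finset.sum_prod_piFinset]
  simp

lemma plsgProb_nonneg {n : ℕ} {Ω : Type*} [Fintype Ω] {ζ : Ω → Ω → ℝ}
    (hζ : ∀ x y, ζ x y ∈ Set.Icc (0 : ℝ) 1) (G : SimpleGraph (Fin n)) : 0 ≤ plsgProb n ζ G :=
  Finset.expect_nonneg fun _ _ => edgeProduct_nonneg (fun _ _ => hζ _ _) G

lemma sum_plsgProb {n : ℕ} {Ω : Type*} [Fintype Ω] [Nonempty Ω] (ζ : Ω → Ω → ℝ) :
    ∑ G, plsgProb n ζ G = 1 := by
  simp only [plsgProb]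
  rw [← Finset.expect_sum_comm]
  simp [sum_edgeProduct]

/-! ### Neighbourhood of a new vertex -/

/-- The probability that the neighbours of a new vertex with a uniform latent vector are given by
`b`, when the other vertices have latent vectors `x`. -/
noncomputable def rowProb {n : ℕ} {Ω : Type*} [Fintype Ω] (ζ : Ω → Ω → ℝ) (x : Fin n → Ω)
    (b : Fin n → Bool) : ℝ :=
  𝔼 y, ∏ j, if b j then ζ y (x j) else 1 - ζ y (x j)

lemma rowProb_nonneg {n : ℕ} {Ω : Type*} [Fintype Ω] {ζ : Ω → Ω → ℝ}
    (hζ : ∀ x y, ζ x y ∈ Set.Icc (0 : ℝ) 1) (x : Fin n → Ω) (b : Fin n → Bool) :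
    0 ≤ rowProb ζ x b := by
  refine Finset.expect_nonneg fun y _ => Finset.prod_nonneg fun j _ => ?_
  split_ifs
  · exact (hζ _ _).1
  · exact sub_nonneg.2 (hζ _ _).2

lemma sum_rowProb {n : ℕ} {Ω : Type*} [Fintype Ω] [Nonempty Ω] (ζ : Ω → Ω → ℝ) (x : Fin n → Ω) :
    ∑ b, rowProb ζ x b = 1 := by
  simp only [rowProb]
  rw [← Finset.expect_sum_comm]
  simp [sum_prod_ite]

lemma plsgProb_succ {n : ℕ} {Ω : Type*} [Fintype Ω] (ζ : Ω → Ω → ℝ)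
    (G : SimpleGraph (Fin (n + 1))) :
    plsgProb (n + 1) ζ G = 𝔼 x : Fin n → Ω,
      edgeProduct (fun i j => ζ (x i) (x j)) (SimpleGraph.finSuccEquiv n G).1 *
        rowProb ζ x (SimpleGraph.finSuccEquiv n G).2 := by
  rw [plsgProb, expect_fin_cons, Finset.expect_comm]
  refine Finset.expect_congr rfl fun x _ => ?_
  rw [rowProb, Finset.mul_expect]
  refine Finset.expect_congr rfl fun y _ => ?_
  simp [edgeProduct_succ]

/-- The second moment of the likelihood ratio of the neighbourhood of a new vertex. -/
lemma expect_sum_rowProb_sq_div {Γ : Type*} [Group Γ] [Fintype Γ] {σ : Γ → ℝ} {p : ℝ}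
    (hp : p ∈ Set.Ioo (0 : ℝ) 1) (n : ℕ) :
    𝔼 x : Fin n → Γ, ∑ b : Fin n → Bool,
      rowProb (fun x y => σ (x⁻¹ * y)) x b ^ 2 / ∏ j, (if b j then p else 1 - p)
    = 𝔼 g, (1 + autocorrelation p σ g / (p * (1 - p))) ^ n := by
  have hp0 : p ≠ 0 := hp.1.ne'
  have hp1 : 1 - p ≠ 0 := (sub_pos.2 hp.2).ne'
  have h1 : ∀ x : Fin n → Γ, ∑ b : Fin n → Bool,
      rowProb (fun x y => σ (x⁻¹ * y)) x b ^ 2 / ∏ j, (if b j then p else 1 - p)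
      -- The square becomes two independent copies `y`, `y'`; the sum over `b` factorises through `s
      -- t / p + (1 - s) (1 - t) / (1 - p) = 1 + (s - p) (t - p) / (p (1 - p))`.
      = 𝔼 y, 𝔼 y', ∏ j, (1 + (σ (y⁻¹ * x j) - p) * (σ (y'⁻¹ * x j) - p) / (p * (1 - p))) := by
    intro x
    simp only [rowProb, sq, Finset.expect_mul_expect, Finset.expect_div]
    rw [← Finset.expect_sum_comm]
    refine Finset.expect_congr rfl fun y _ => ?_
    rw [← Finset.expect_sum_comm]
    refine Finset.expect_congr rfl fun y' _ => ?_
    have h2 : ∀ b : Fin n → Bool,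
        (∏ j, if b j then σ (y⁻¹ * x j) else 1 - σ (y⁻¹ * x j)) *
          (∏ j, if b j then σ (y'⁻¹ * x j) else 1 - σ (y'⁻¹ * x j)) /
            ∏ j, (if b j then p else 1 - p)
        = ∏ j, if b j then σ (y⁻¹ * x j) * σ (y'⁻¹ * x j) / p
            else (1 - σ (y⁻¹ * x j)) * (1 - σ (y'⁻¹ * x j)) / (1 - p) := by
      intro b
      rw [← Finset.prod_mul_distrib, ← Finset.prod_div_distrib]
      refine Finset.prod_congr rfl fun j _ => ?_
      split_ifs <;> rfl
    simp only [h2, sum_prod_ite]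
    refine Finset.prod_congr rfl fun j _ => ?_
    field_simp
    ring
  simp only [h1]
  rw [Finset.expect_comm]
  have h3 : ∀ y : Γ, 𝔼 x : Fin n → Γ, 𝔼 y' : Γ,
      ∏ j, (1 + (σ (y⁻¹ * x j) - p) * (σ (y'⁻¹ * x j) - p) / (p * (1 - p)))
      = 𝔼 g, (1 + autocorrelation p σ g / (p * (1 - p))) ^ n := by
    intro y
    rw [Finset.expect_comm]
    have h4 : ∀ y' : Γ, 𝔼 x : Fin n → Γ,
        ∏ j, (1 + (σ (y⁻¹ * x j) - p) * (σ (y'⁻¹ * x j) - p) / (p * (1 - p)))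
        = (1 + autocorrelation p σ (y'⁻¹ * y) / (p * (1 - p))) ^ n := by
      intro y'
      rw [expect_prod_pi n
        (fun z => 1 + (σ (y⁻¹ * z) - p) * (σ (y'⁻¹ * z) - p) / (p * (1 - p)))]
      congr 1
      rw [Finset.expect_add_distrib, ← Finset.expect_div, autocorrelation,
        ← expect_mul_left (fun z => (σ (y⁻¹ * z) - p) * (σ (y'⁻¹ * z) - p)) y]
      simp [mul_assoc]
    simp only [h4]
    rw [expect_inv (fun y' => (1 + autocorrelation p σ (y' * y) / (p * (1 - p))) ^ n),
      expect_mul_right (fun g => (1 + autocorrelation p σ g / (p * (1 - p))) ^ n)]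
  simp [h3]

/-- The same identity, read backwards, gives an average of nonnegative terms. This allows `1 + t ≤
exp t` to be raised to powers. -/
lemma one_add_autocorrelation_div_nonneg {Γ : Type*} [Group Γ] [Fintype Γ] {σ : Γ → ℝ} {p : ℝ}
    (hp : p ∈ Set.Ioo (0 : ℝ) 1) (hσ01 : ∀ x, σ x ∈ Set.Icc (0 : ℝ) 1)
    (g : Γ) : 0 ≤ 1 + autocorrelation p σ g / (p * (1 - p)) := by
  have hp0 := hp.1
  have hp1 := sub_pos.2 hp.2
  have : 1 + autocorrelation p σ g / (p * (1 - p))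
      = 𝔼 z, (1 + (σ z - p) * (σ (g * z) - p) / (p * (1 - p))) := by
    rw [Finset.expect_add_distrib, ← Finset.expect_div, autocorrelation]
    simp
  rw [this]
  refine Finset.expect_nonneg fun z _ => ?_
  have h : 1 + (σ z - p) * (σ (g * z) - p) / (p * (1 - p))
      = σ z * σ (g * z) / p + (1 - σ z) * (1 - σ (g * z)) / (1 - p) := by
    field_simp
    ring
  rw [h]
  have h1 := hσ01 z
  have h2 := hσ01 (g * z)
  have := mul_nonneg h1.1 h2.1
  have := mul_nonneg (sub_nonneg.2 h1.2) (sub_nonneg.2 h2.2)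
  positivity

/-- The chain rule bound for the divergence of a random algebraic graph. -/
lemma sum_plsgProb_mul_log_le {Γ : Type*} [Group Γ] [Fintype Γ] {σ : Γ → ℝ} {p c : ℝ}
    (hp : p ∈ Set.Ioo (0 : ℝ) 1) (hσ01 : ∀ x, σ x ∈ Set.Icc (0 : ℝ) 1)
    (hc : ∀ k : ℕ, 𝔼 g, (1 + autocorrelation p σ g / (p * (1 - p))) ^ k
      ≤ Real.exp ((k : ℝ) ^ 2 * c)) (hc0 : 0 ≤ c) (n : ℕ) :
    ∑ G, plsgProb n (fun x y => σ (x⁻¹ * y)) G *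
      Real.log (plsgProb n (fun x y => σ (x⁻¹ * y)) G / edgeProduct (fun _ _ => p) G)
      ≤ (n : ℝ) ^ 3 * c := by
  induction n with
  | zero => simp [plsgProb, edgeProduct]
  | succ n ih =>
    have hζ : ∀ x y : Γ, σ (x⁻¹ * y) ∈ Set.Icc (0 : ℝ) 1 := fun _ _ => hσ01 _
    have hstep := sum_mul_log_expect_mul_le
      (e := fun (x : Fin n → Γ) G => edgeProduct (fun i j => σ ((x i)⁻¹ * x j)) G)
      (W := fun x b => rowProb (fun x y => σ (x⁻¹ * y)) x b)
      (Q := fun G => edgeProduct (fun _ _ => p) G)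
      (q := fun b => ∏ j, if b j then p else 1 - p) (c := (n : ℝ) ^ 2 * c)
      (fun x => edgeProduct_nonneg fun _ _ => hζ _ _) (rowProb_nonneg hζ)
      (edgeProduct_pos fun _ _ => hp)
      (fun b => Finset.prod_pos fun j _ => by
        split_ifs
        · exact hp.1
        · exact sub_pos.2 hp.2)
      (fun x => sum_edgeProduct _) (sum_rowProb _)
      ((expect_sum_rowProb_sq_div hp n).trans_le (hc n))
    rw [← (SimpleGraph.finSuccEquiv n).symm.sum_comp, Fintype.sum_prod_type]
    simp only [plsgProb_succ, edgeProduct_succ, Equiv.apply_symm_apply]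
    refine hstep.trans ?_
    -- The sum of `k ^ 2` over `k < n` is bounded crudely by `n ^ 3`.
    have h2 : (n : ℝ) ^ 3 * c + (n : ℝ) ^ 2 * c ≤ ((n + 1 : ℕ) : ℝ) ^ 3 * c := by
      rw [← add_mul]
      refine mul_le_mul_of_nonneg_right ?_ hc0
      push_cast
      nlinarith [sq_nonneg (n : ℝ), Nat.cast_nonneg (α := ℝ) n]
    simp only [plsgProb] at ih
    linarith

/-! ### From point masses to measures on graphs -/

instance SimpleGraph.instMeasurableSingletonClass {V : Type*} [Countable V] :
    MeasurableSingletonClass (SimpleGraph V) where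
  measurableSet_singleton G := by
    have : {G} = SimpleGraph.edgeSet ⁻¹' ({G.edgeSet} : Set (Set (Sym2 V))) := by
      ext H; simp
    rw [this]
    exact SimpleGraph.measurable_edgeSet (measurableSet_singleton _)

lemma klDiv_fintype {α : Type*} [Fintype α] [MeasurableSpace α] [MeasurableSingletonClass α]
    {μ ν : Measure α} [IsProbabilityMeasure μ] [IsProbabilityMeasure ν] (hν : ∀ a, ν {a} ≠ 0) :
    InformationTheory.klDiv μ ν
      = ENNReal.ofReal (∑ a, μ.real {a} * Real.log (μ.real {a} / ν.real {a})) := by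
  have hac : μ ≪ ν := by
    intro s hs
    have : s = ∅ := by
      by_contra h
      obtain ⟨a, ha⟩ := Set.nonempty_iff_ne_empty.2 h
      exact hν a (measure_mono_null (Set.singleton_subset_iff.2 ha) hs)
    simp [this]
  rw [InformationTheory.klDiv_of_ac_of_integrable hac .of_finite, integral_fintype .of_finite]
  simp only [probReal_univ, add_sub_cancel_right, smul_eq_mul]
  congr 1
  refine Finset.sum_congr rfl fun a _ => ?_
  have h : μ {a} = μ.rnDeriv ν a * ν {a} := by
    conv_lhs => rw [← Measure.withDensity_rnDeriv_eq μ ν hac]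
    rw [withDensity_apply _ (measurableSet_singleton a), lintegral_singleton]
  have h' : μ.real {a} / ν.real {a} = (μ.rnDeriv ν a).toReal := by
    rw [measureReal_def, measureReal_def, h, ENNReal.toReal_mul, mul_div_assoc, div_self, mul_one]
    exact (ENNReal.toReal_pos (hν a) (measure_ne_top _ _)).ne'
  rw [h', llr]

lemma PLSG_singleton {n : ℕ} {Ω : Type*} [Fintype Ω] (ζ : Ω → Ω → ℝ) (G : SimpleGraph (Fin n)) :
    PLSG n ζ {G} = ENNReal.ofReal (plsgProb n ζ G) := by
  classical
  rw [PLSG, Measure.finsetSum_apply]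
  simp [Set.indicator_apply]

lemma isProbabilityMeasure_PLSG {n : ℕ} {Ω : Type*} [Fintype Ω] [Nonempty Ω] {ζ : Ω → Ω → ℝ}
    (hζ : ∀ x y, ζ x y ∈ Set.Icc (0 : ℝ) 1) : IsProbabilityMeasure (PLSG n ζ) := by
  constructor
  rw [PLSG, Measure.finsetSum_apply]
  simp only [Measure.smul_apply, measure_univ, smul_eq_mul, mul_one]
  rw [← ENNReal.ofReal_sum_of_nonneg fun G _ => plsgProb_nonneg hζ G, sum_plsgProb,
    ENNReal.ofReal_one]

/-- Each edge is listed exactly once as an ordered pair `i < j`. -/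
lemma prod_ite_adj_eq_pow {n : ℕ} (a : ℝ) (G : SimpleGraph (Fin n)) [DecidableRel G.Adj] :
    ∏ i : Fin n, ∏ j ∈ Finset.Ioi i, (if G.Adj i j then a else 1) = a ^ G.edgeFinset.card := by
  classical
  have himg : G.edgeFinset = ((Finset.univ.sigma fun i : Fin n => Finset.Ioi i).filter
      fun e => G.Adj e.1 e.2).image fun e => s(e.1, e.2) := by
    ext e
    induction e using Sym2.ind with
    | _ i j =>
      simp only [SimpleGraph.mem_edgeFinset, SimpleGraph.mem_edgeSet, Finset.mem_image,
        Finset.mem_filter, Finset.mem_sigma, Finset.mem_univ, Finset.mem_Ioi, true_and]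
      constructor
      · intro h
        rcases lt_or_gt_of_ne h.ne with hij | hij
        · exact ⟨⟨i, j⟩, ⟨hij, h⟩, rfl⟩
        · exact ⟨⟨j, i⟩, ⟨hij, h.symm⟩, Sym2.eq_swap⟩
      · rintro ⟨⟨k, l⟩, ⟨-, h⟩, he⟩
        rw [← SimpleGraph.mem_edgeSet, ← he]
        exact h
  rw [Finset.prod_sigma', Finset.prod_ite, Finset.prod_const, Finset.prod_const_one, mul_one,
    himg, Finset.card_image_of_injOn]
  rintro ⟨i, j⟩ hij ⟨k, l⟩ hkl h
  simp only [Finset.coe_filter, Finset.mem_sigma, Finset.mem_univ, Finset.mem_Ioi, true_and,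
    Set.mem_ofPred_eq] at hij hkl
  rcases Sym2.eq_iff.1 h with ⟨rfl, rfl⟩ | ⟨rfl, rfl⟩
  · rfl
  · exact absurd hij.1 hkl.1.not_gt

lemma edgeProduct_const {n : ℕ} (p : ℝ) (G : SimpleGraph (Fin n)) :
    edgeProduct (fun _ _ => p) G
      = p ^ G.edgeSet.ncard * (1 - p) ^ (n.choose 2 - G.edgeSet.ncard) := by
  classical
  have hsplit : edgeProduct (fun _ _ => p) G
      = (∏ i : Fin n, ∏ j ∈ Finset.Ioi i, (if G.Adj i j then p else 1)) *
        ∏ i : Fin n, ∏ j ∈ Finset.Ioi i, (if Gᶜ.Adj i j then 1 - p else 1) := by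
    rw [edgeProduct, ← Finset.prod_mul_distrib]
    refine Finset.prod_congr rfl fun i _ => ?_
    rw [← Finset.prod_mul_distrib]
    refine Finset.prod_congr rfl fun j hj => ?_
    have hij : i ≠ j := (Finset.mem_Ioi.1 hj).ne
    by_cases h : G.Adj i j <;> simp [h, hij]
  have hcard : G.edgeFinset.card + Gᶜ.edgeFinset.card = n.choose 2 := by
    have := SimpleGraph.card_edgeFinset_top_eq_card_choose_two (V := Fin n)
    rw [Fintype.card_fin] at this
    rw [← this, ← Finset.card_union_of_disjoint
      (SimpleGraph.disjoint_edgeFinset.2 disjoint_compl_right), ← SimpleGraph.edgeFinset_sup]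
    congr! 2
    exact sup_compl_eq_top
  rw [hsplit, prod_ite_adj_eq_pow, prod_ite_adj_eq_pow, ← SimpleGraph.coe_edgeFinset,
    Set.ncard_coe_finset, ← hcard, Nat.add_sub_cancel_left]

lemma binomialRandom_singleton_eq_edgeProduct {n : ℕ} (p : unitInterval)
    (G : SimpleGraph (Fin n)) :
    SimpleGraph.binomialRandom (Fin n) p {G}
      = ENNReal.ofReal (edgeProduct (fun _ _ => (p : ℝ)) G) := by
  rw [SimpleGraph.binomialRandom_singleton, edgeProduct_const, Nat.card_fin,
    ENNReal.ofReal_mul (pow_nonneg p.2.1 _), ENNReal.ofReal_pow p.2.1,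
    ENNReal.ofReal_pow (sub_nonneg.2 p.2.2)]
  congr 2
  · congr 1
    exact NNReal.eq (Real.coe_toNNReal _ p.2.1).symm
  · congr 1
    exact NNReal.eq (Real.coe_toNNReal _ (sub_nonneg.2 p.2.2)).symm

lemma klDiv_RAG_le {Γ : Type*} [Group Γ] [Fintype Γ] {σ : Γ → ℝ} {p : unitInterval} {c : ℝ}
    (hp : (p : ℝ) ∈ Set.Ioo (0 : ℝ) 1) (hσ01 : ∀ x, σ x ∈ Set.Icc (0 : ℝ) 1)
    (hc : ∀ k : ℕ, 𝔼 g, (1 + autocorrelation p σ g / (p * (1 - p))) ^ k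
      ≤ Real.exp ((k : ℝ) ^ 2 * c)) (hc0 : 0 ≤ c) (n : ℕ) :
    InformationTheory.klDiv (RAG n Γ σ) (SimpleGraph.binomialRandom (Fin n) p)
      ≤ ENNReal.ofReal ((n : ℝ) ^ 3 * c) := by
  have hζ : ∀ x y : Γ, σ (x⁻¹ * y) ∈ Set.Icc (0 : ℝ) 1 := fun _ _ => hσ01 _
  have := isProbabilityMeasure_PLSG (n := n) hζ
  have hpos := fun G : SimpleGraph (Fin n) => edgeProduct_pos (fun _ _ => hp) G
  rw [RAG, klDiv_fintype fun G => by
    rw [binomialRandom_singleton_eq_edgeProduct]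
    exact (ENNReal.ofReal_pos.2 (hpos G)).ne']
  refine ENNReal.ofReal_le_ofReal ?_
  simp only [measureReal_def, PLSG_singleton, binomialRandom_singleton_eq_edgeProduct,
    ENNReal.toReal_ofReal (plsgProb_nonneg hζ _), ENNReal.toReal_ofReal (hpos _).le]
  exact sum_plsgProb_mul_log_le hp hσ01 hc hc0 n

/-! ### Degenerate densities and the limit -/

lemma RAG_const {Γ : Type*} [Group Γ] [Fintype Γ] {σ : Γ → ℝ} {p : unitInterval}
    (hσ : ∀ x, σ x = p) (n : ℕ) : RAG n Γ σ = SimpleGraph.binomialRandom (Fin n) p := by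
  refine Measure.ext_of_singleton fun G => ?_
  rw [RAG, PLSG_singleton, binomialRandom_singleton_eq_edgeProduct, plsgProb]
  simp [hσ]

lemma IsConnection.eq_zero {d : ℕ} {σ : Cube d → ℝ} (h : IsConnection 0 σ) (x : Cube d) :
    σ x = 0 := by
  have := h.2
  rw [Finset.expect_eq_zero_iff_of_nonneg fun x _ => (h.1 x).1] at this
  exact this x (Finset.mem_univ x)

lemma IsConnection.one_sub {d : ℕ} {p : ℝ} {σ : Cube d → ℝ} (h : IsConnection p σ) :
    IsConnection (1 - p) fun x => 1 - σ x := by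
  refine ⟨fun x => ⟨sub_nonneg.2 (h.1 x).2, sub_le_self _ (h.1 x).1⟩, ?_⟩
  rw [Finset.expect_sub_distrib, h.2]
  simp

/-- The Kullback-Leibler divergence of the random algebraic graph of a Lipschitz connection from
the binomial random graph. Neither symmetry nor a lower bound on the dimension is needed. -/
lemma klDiv_RAG_cube_le {d : ℕ} {L : ℝ} {p : unitInterval} {σ : Cube d → ℝ}
    (hσ : IsConnection (p : ℝ) σ) (hL : HammingLipschitz L σ) (n : ℕ) :
    InformationTheory.klDiv (RAG n (Cube d) σ) (SimpleGraph.binomialRandom (Fin n) p)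
      ≤ ENNReal.ofReal ((n : ℝ) ^ 3 * (d * L ^ 4 / (p * (1 - p) : ℝ) ^ 2)) := by
  by_cases hp : (p : ℝ) ∈ Set.Ioo (0 : ℝ) 1
  · refine klDiv_RAG_le hp hσ.1 (fun k => ?_) (by positivity) n
    exact expect_one_add_autocorrelation_pow_le (mul_pos hp.1 (sub_pos.2 hp.2)) hL hσ.2
      (one_add_autocorrelation_div_nonneg hp hσ.1) k
  -- For `p` equal to `0` or `1` the bound reads `0`, by division by zero, so the two laws must
  -- coincide exactly.
  · have hconst : ∀ x, σ x = p := by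
      have hp01 : (p : ℝ) = 0 ∨ (p : ℝ) = 1 := by
        by_contra! h
        exact hp ⟨p.2.1.lt_of_ne h.1.symm, p.2.2.lt_of_ne h.2⟩
      rcases hp01 with h | h
      · rw [h] at hσ ⊢
        exact hσ.eq_zero
      · rw [h] at hσ ⊢
        have h1 := hσ.one_sub
        rw [sub_self] at h1
        exact fun x => (sub_eq_zero.1 (h1.eq_zero x)).symm
    rw [RAG_const hconst, InformationTheory.klDiv_self]
    exact zero_le

theorem corollary4p4 :
    ∃ C : ℝ → ℝ, (∀ q, 0 < C q) ∧ ContinuousOn C (Set.Ioo 0 1) ∧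
      ∀ (d : ℕ → ℕ) (r : ℕ → ℝ) (p : ℕ → unitInterval) (σ : ∀ n, Cube (d n) → ℝ),
        (∀ n, 0 < r n) →
        (∀ n, IsConnection (p n : ℝ) (σ n)) →
        (∀ n, IsSymmetricConnection (σ n)) →
        (∀ n, HammingLipschitz (1 / (r n * Real.sqrt (d n))) (σ n)) →
        (fun n : ℕ => C (p n) * ((n : ℝ) ^ 3 / r n ^ 4)) =o[atTop] (fun n : ℕ => (d n : ℝ)) →
        (fun n : ℕ => (n : ℝ) * Real.log n) =O[atTop] (fun n : ℕ => (d n : ℝ)) →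
        Tendsto
          (fun n : ℕ => InformationTheory.klDiv (RAG n (Cube (d n)) (σ n))
            (SimpleGraph.binomialRandom (Fin n) (p n)))
          atTop (𝓝 0) := by
  -- The added `1` keeps `C` positive at the endpoints, where the inverse is `0` by convention.
  refine ⟨fun q => 1 + ((q * (1 - q)) ^ 2)⁻¹, fun q => by positivity, ?_, ?_⟩
  · refine continuousOn_const.add (ContinuousOn.inv₀ (by fun_prop) fun q hq => ?_)
    exact (pow_pos (mul_pos hq.1 (sub_pos.2 hq.2)) 2).ne'
  intro d r p σ hr hσ _ hL hd _
  have hlim := ENNReal.tendsto_ofReal hd.tendsto_div_nhds_zero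
  rw [ENNReal.ofReal_zero] at hlim
  refine tendsto_of_tendsto_of_tendsto_of_le_of_le tendsto_const_nhds hlim
    (fun _ => zero_le) fun n => ?_
  refine (klDiv_RAG_cube_le (hσ n) (hL n) n).trans (ENNReal.ofReal_le_ofReal ?_)
  have hrn := hr n
  -- If `d n = 0`, both sides vanish, the right one through division by zero.
  rcases Nat.eq_zero_or_pos (d n) with h0 | h0
  · simp [h0]
  have hd0 : (0 : ℝ) < d n := by exact_mod_cast h0
  have hsq : Real.sqrt (d n) ^ 4 = (d n : ℝ) ^ 2 := by
    rw [show 4 = 2 * 2 from rfl, pow_mul, Real.sq_sqrt hd0.le]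
  have heq : (n : ℝ) ^ 3 * (d n * (1 / (r n * Real.sqrt (d n))) ^ 4 /
      ((p n : ℝ) * (1 - p n)) ^ 2)
      = (((p n : ℝ) * (1 - p n)) ^ 2)⁻¹ * ((n : ℝ) ^ 3 / r n ^ 4) / d n := by
    rw [div_pow, mul_pow, hsq]
    field_simp
  rw [heq]
  gcongr
  linarith
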